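/- **Theorem (Soundness Theorem for CBPV).** *Types.* Value types $\varphi ::= U\kappa \mid \mathsf{unit} \mid \varphi_1\boxplus\varphi_2 \mid \varphi_1\boxtimes\varphi_2$ and computation types $\kappa ::= \alpha \mid F\varphi \mid \varphi\rightarrowtriangle\kappa \mid \kappa_1\otimes\kappa_2 \mid \mu\alpha.\kappa$, where $\alpha$ ranges over type variables; types are taken modulo renaming of bound type variables. $\tau$ denotes a closed value or computation type. Contexts $\Gamma,\Delta$ are finite sequences of variables of closed value types; a renaming $r\colon\Gamma\to\Delta$ is a type-preserving map of variables. *Terms* $\Gamma\vdash t:\tau$ (modulo $\alpha$-equivalence; all types closed) are generated by the values: variables; $\star:\mathsf{unit}$; $\mathsf{inl}(v),\mathsf{inr}(v):\varphi_1\boxplus\varphi_2$; $\mathsf{pair}(v,w):\varphi_1\boxtimes\varphi_2$; $\mathsf{thunk}(t):U\kappa$ for $t:\kappa$; and the computations: $\mathsf{prod}(v):F\varphi$ for $v:\varphi$; $\mathsf{force}(v):\kappa$ for $v:U\kappa$; $\mathsf{lam}\,x.t:\varphi\rightarrowtriangle\kappa$ for $\Gamma,x:\varphi\vdash t:\kappa$;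 $\mathsf{app}(t,v):\kappa$ for $t:\varphi\rightarrowtriangle\kappa$, $v:\varphi$; $\mathsf{pair}(t,s):\kappa_1\otimes\kappa_2$; $\mathsf{fst}(t):\kappa_1$ and $\mathsf{snd}(t):\kappa_2$ for $t:\kappa_1\otimes\kappa_2$; $\mathsf{fold}(t):\mu\alpha.\kappa$ for $t:\kappa[\mu\alpha.\kappa/\alpha]$; $\mathsf{unfold}(t):\kappa[\mu\alpha.\kappa/\alpha]$ for $t:\mu\alpha.\kappa$; $t\oplus s:\kappa$ for $t,s:\kappa$; $s\ \mathsf{to}\ x\ \mathsf{in}\ t:\kappa$ for $s:F\varphi$ and $\Gamma,x:\varphi\vdash t:\kappa$; $\mathsf{case}(v,x.s,y.r):\kappa$ for $v:\varphi_1\boxplus\varphi_2$, $\Gamma,x:\varphi_1\vdash s:\kappa$ and $\Gamma,y:\varphi_2\vdash r:\kappa$; $\mathsf{pm}(v,(x,y).t):\kappa$ for $v:\varphi_1\boxtimes\varphi_2$ and $\Gamma,x:\varphi_1,y:\varphi_2\vdash t:\kappa$. Let $\Lambda_\tau(\Gamma)=\{t\mid\Gamma\vdash t:\tau\}$. With renaming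 of free variables, $\Lambda_\tau$ is a presheaf on contexts and renamings. Substitutions $\vec u\colon\Gamma\to\Delta$ assign to every variable of $\Gamma$ a value of the same type over $\Delta$. *Reduction* $\to$ on (open) computations is generated by $\mathsf{unfold}(\mathsf{fold}(t))\to t$; $\mathsf{app}(\mathsf{lam}\,x.t,v)\to t[v/x]$; $\mathsf{fst}(\mathsf{pair}(t,s))\to t$; $\mathsf{snd}(\mathsf{pair}(t,s))\to s$; $t\oplus s\to t$; $t\oplus s\to s$; $\mathsf{prod}(v)\ \mathsf{to}\ x\ \mathsf{in}\ t\to\mathsf{app}(\mathsf{lam}\,x.t,v)$; $\mathsf{case}(\mathsf{inl}(v),x.s,y.r)\to\mathsf{app}(\mathsf{lam}\,x.s,v)$; $\mathsf{case}(\mathsf{inr}(v),x.s,y.r)\to\mathsf{app}(\mathsf{lam}\,y.r,v)$; $\mathsf{force}(\mathsf{thunk}(t))\to t$; $\mathsf{pm}(\mathsf{pair}(v,w),(x,y).t)\to\mathsf{app}(\mathsf{lam}\,y.\mathsf{app}(\mathsf{lam}\,x.t,v),w)$; and closure under the evaluation contexts $\mathsf{unfold}(\cdot)$, $\mathsf{app}(\cdot,v)$,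 $\mathsf{fst}(\cdot)$, $\mathsf{snd}(\cdot)$, $\cdot\ \mathsf{to}\ x\ \mathsf{in}\ t$. Let $\Rightarrow$ be the reflexive transitive closure of $\to$, and write $t{\Downarrow}$ if $t\Rightarrow t'$ for some $t'$ of the form $\mathsf{prod}(v)$, $\mathsf{lam}\,x.s$, $\mathsf{pair}(s,s')$ or $\mathsf{fold}(s)$. (For closed $t$: iff $t$ reduces to a term that does not reduce further.) *Contextual preorder.* A relation $R$ on $\Lambda$ is a family $R_\tau(\Gamma)\subseteq\Lambda_\tau(\Gamma)\times\Lambda_\tau(\Gamma)$ compatible with renamings; it is a congruence if it is respected by all operations (including variables and $\star$). The contextual preorder $\lesssim^{\mathsf{ctx}}$ is the greatest congruence contained in $O$, where $O_\varphi(\Gamma)=\Lambda_\varphi(\Gamma)\times\Lambda_\varphi(\Gamma)$ and $O_\kappa(\Gamma)=\{(t,s)\mid t{\Downarrow}\Rightarrow s{\Downarrow}\}$. *Simulation and logical relation.* For families of relations $Q,S$ let $\mathcal B(Q,S)_\tau(\Gamma)(t,s)$ hold iff 1. $S_\tau(\Delta)(t[\vec u],s[\vec w])$ for all $\Delta$ and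 all substitutions $\vec u,\vec w\colon\Gamma\to\Delta$ that are componentwise related by $Q$; 2. if $t\to t'$ then $s\Rightarrow s'$ with $S(t',s')$ for some $s'$; 3. if $t=\star$ then $s=\star$; if $t=\mathsf{thunk}(t')$ then $s=\mathsf{thunk}(s')$ with $S(t',s')$; if $t=\mathsf{inl}(v)$ then $s=\mathsf{inl}(w)$ with $S(v,w)$, and likewise for $\mathsf{inr}$; if $t=\mathsf{pair}(v_1,v_2)$ is a value then $s=\mathsf{pair}(w_1,w_2)$ with $S(v_1,w_1)$ and $S(v_2,w_2)$; 4. if $t$ is the computation $\mathsf{pair}(t_1,t_2)$ then $s\Rightarrow\mathsf{pair}(s_1,s_2)$ with $S(t_1,s_1)$ and $S(t_2,s_2)$; if $t=\mathsf{fold}(t')$ then $s\Rightarrow\mathsf{fold}(s')$ with $S(t',s')$; if $t=\mathsf{prod}(v)$ then $s\Rightarrow\mathsf{prod}(w)$ with $S(v,w)$; 5. if $t=\mathsf{lam}\,x{:}\varphi.M$ then $s\Rightarrow\mathsf{lam}\,x{:}\varphi.N$ for some $N$ such that, for every renaming $r\colon\Gamma\to\Delta$ and all $v,w\in\Lambda_\varphi(\Delta)$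 with $Q_\varphi(\Delta)(v,w)$, one has $S(M[r,v/x],N[r,w/x])$. Applicative similarity $\lesssim^{\mathsf{app}}$ is the union of all applicative simulations, i.e. relations $R$ on $\Lambda$ with $R\subseteq\mathcal B(=,R)$. The step-indexed logical relation is $\mathcal L=\bigcap_\alpha\mathcal L^\alpha$ over all ordinals $\alpha$, where $\mathcal L^0=\Lambda\times\Lambda$, $\mathcal L^{\alpha+1}=\mathcal L^\alpha\cap\mathcal B(\mathcal L^\alpha,\mathcal L^\alpha)$, and $\mathcal L^\alpha=\bigcap_{\beta<\alpha}\mathcal L^\beta$ for limit ordinals $\alpha$. **Claim.** For all contexts $\Gamma$, closed types $\tau$ and terms $p,q\in\Lambda_\tau(\Gamma)$, $$p\lesssim^{\mathsf{app}}q\implies p\lesssim^{\mathsf{ctx}}q\qquad\text{and}\qquad\mathcal L(p,q)\implies p\lesssim^{\mathsf{ctx}}q.$$ -/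

import Mathlib

namespace CBPV

/-! ### Types -/

/-- The two sorts of types: value types and computation types. -/
inductive Kind : Type
  | val
  | comp

/-- `Ty k n`: types of sort `k` with free (computation) type variables among `0, …, n - 1`, modulo
renaming of bound type variables (de Bruijn indices; `mu` binds the variable `0`). -/
inductive Ty : Kind → ℕ → Type
  | U {n : ℕ} : Ty .comp n → Ty .val n
  | unit {n : ℕ} : Ty .val n
  | sum {n : ℕ} : Ty .val n → Ty .val n → Ty .val n
  | times {n : ℕ} : Ty .val n → Ty .val n → Ty .val n
  | tvar {n : ℕ} : Fin n → Ty .comp n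
  | F {n : ℕ} : Ty .val n → Ty .comp n
  | arr {n : ℕ} : Ty .val n → Ty .comp n → Ty .comp n
  | tensor {n : ℕ} : Ty .comp n → Ty .comp n → Ty .comp n
  | mu {n : ℕ} : Ty .comp (n + 1) → Ty .comp n

/-- Renaming of type variables. -/
def Ty.rename : ∀ {k : Kind} {m n : ℕ}, (Fin m → Fin n) → Ty k m → Ty k n
  | _, _, _, r, .U κ => .U (κ.rename r)
  | _, _, _, _, .unit => .unit
  | _, _, _, r, .sum φ₁ φ₂ => .sum (φ₁.rename r) (φ₂.rename r)
  | _, _, _, r, .times φ₁ φ₂ => .times (φ₁.rename r) (φ₂.rename r)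
  | _, _, _, r, .tvar i => .tvar (r i)
  | _, _, _, r, .F φ => .F (φ.rename r)
  | _, _, _, r, .arr φ κ => .arr (φ.rename r) (κ.rename r)
  | _, _, _, r, .tensor κ₁ κ₂ => .tensor (κ₁.rename r) (κ₂.rename r)
  | _, _, _, r, .mu κ => .mu (κ.rename (Fin.cases 0 (fun i => (r i).succ)))

/-- Capture-avoiding simultaneous substitution of computation types for type variables. -/
def Ty.subst : ∀ {k : Kind} {m n : ℕ}, (Fin m → Ty .comp n) → Ty k m → Ty k n
  | _, _, _, s, .U κ => .U (κ.subst s)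
  | _, _, _, _, .unit => .unit
  | _, _, _, s, .sum φ₁ φ₂ => .sum (φ₁.subst s) (φ₂.subst s)
  | _, _, _, s, .times φ₁ φ₂ => .times (φ₁.subst s) (φ₂.subst s)
  | _, _, _, s, .tvar i => s i
  | _, _, _, s, .F φ => .F (φ.subst s)
  | _, _, _, s, .arr φ κ => .arr (φ.subst s) (κ.subst s)
  | _, _, _, s, .tensor κ₁ κ₂ => .tensor (κ₁.subst s) (κ₂.subst s)
  | _, _, _, s, .mu κ => .mu (κ.subst (Fin.cases (.tvar 0) (fun i => (s i).rename Fin.succ)))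

/-- Closed value types. -/
abbrev VTy : Type := Ty .val 0

/-- Closed computation types. -/
abbrev CTy : Type := Ty .comp 0

/-- `κ[μα.κ/α]`. -/
def Ty.unroll (κ : Ty .comp 1) : CTy := κ.subst (fun _ => .mu κ)

/-! ### Typing contexts and terms -/

/-- Typing contexts: finite sequences of closed value types, the most recent variable first. -/
abbrev Ctx : Type := List VTy

/-- `Var Γ φ`: the variables of type `φ` in the context `Γ`, i.e. the positions of `Γ` that carry
the type `φ`. -/
inductive Var : Ctx → VTy → Type
  | z {Γ : Ctx} {φ : VTy} : Var (φ :: Γ) φ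
  | s {Γ : Ctx} {φ ψ : VTy} : Var Γ φ → Var (ψ :: Γ) φ

/-- `Tm Γ τ`: the well-typed terms `Γ ⊢ t : τ`, for `τ` a closed value or computation type, modulo
renaming of bound variables. -/
inductive Tm : Ctx → ∀ {k : Kind}, Ty k 0 → Type
  | var {Γ : Ctx} {φ : VTy} : Var Γ φ → Tm Γ φ
  | star {Γ : Ctx} : Tm Γ (.unit : VTy)
  | inl {Γ : Ctx} {φ₁ φ₂ : VTy} : Tm Γ φ₁ → Tm Γ (.sum φ₁ φ₂)
  | inr {Γ : Ctx} {φ₁ φ₂ : VTy} : Tm Γ φ₂ → Tm Γ (.sum φ₁ φ₂)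
  | vpair {Γ : Ctx} {φ₁ φ₂ : VTy} : Tm Γ φ₁ → Tm Γ φ₂ → Tm Γ (.times φ₁ φ₂)
  | thunk {Γ : Ctx} {κ : CTy} : Tm Γ κ → Tm Γ (.U κ)
  | prod {Γ : Ctx} {φ : VTy} : Tm Γ φ → Tm Γ (.F φ)
  | force {Γ : Ctx} {κ : CTy} : Tm Γ (.U κ) → Tm Γ κ
  | lam {Γ : Ctx} {φ : VTy} {κ : CTy} : Tm (φ :: Γ) κ → Tm Γ (.arr φ κ)
  | app {Γ : Ctx} {φ : VTy} {κ : CTy} : Tm Γ (.arr φ κ) → Tm Γ φ → Tm Γ κ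
  | cpair {Γ : Ctx} {κ₁ κ₂ : CTy} : Tm Γ κ₁ → Tm Γ κ₂ → Tm Γ (.tensor κ₁ κ₂)
  | fst {Γ : Ctx} {κ₁ κ₂ : CTy} : Tm Γ (.tensor κ₁ κ₂) → Tm Γ κ₁
  | snd {Γ : Ctx} {κ₁ κ₂ : CTy} : Tm Γ (.tensor κ₁ κ₂) → Tm Γ κ₂
  | fold {Γ : Ctx} {κ : Ty .comp 1} : Tm Γ κ.unroll → Tm Γ (.mu κ)
  /-- the type of `unfold t` is `κ[μα.κ/α]`; it is a separate variable `κ'` only to keep the indices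
  of the family free of function calls -/
  | unfold {Γ : Ctx} {κ : Ty .comp 1} {κ' : CTy} : κ.unroll = κ' → Tm Γ (.mu κ) → Tm Γ κ'
  | choice {Γ : Ctx} {κ : CTy} : Tm Γ κ → Tm Γ κ → Tm Γ κ
  /-- `s to x in t` -/
  | toIn {Γ : Ctx} {φ : VTy} {κ : CTy} : Tm Γ (.F φ) → Tm (φ :: Γ) κ → Tm Γ κ
  /-- `case(v, x.s, y.r)` -/
  | caseOf {Γ : Ctx} {φ₁ φ₂ : VTy} {κ : CTy} :
      Tm Γ (.sum φ₁ φ₂) → Tm (φ₁ :: Γ) κ → Tm (φ₂ :: Γ) κ → Tm Γ κ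
  /-- `pm(v, (x, y).t)`; in the body, `x : φ₁` is the variable `z` and `y : φ₂` the variable `s z` -/
  | pm {Γ : Ctx} {φ₁ φ₂ : VTy} {κ : CTy} :
      Tm Γ (.times φ₁ φ₂) → Tm (φ₁ :: φ₂ :: Γ) κ → Tm Γ κ

/-! ### Renaming and substitution -/

/-- Renamings `Γ → Δ`: type-preserving maps of variables. -/
abbrev Ren (Γ Δ : Ctx) : Type := ∀ ⦃φ : VTy⦄, Var Γ φ → Var Δ φ

/-- Extension of a renaming under a binder. -/
def Ren.lift {Γ Δ : Ctx} (r : Ren Γ Δ) (ψ : VTy) : Ren (ψ :: Γ) (ψ :: Δ)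
  | _, .z => .z
  | _, .s x => .s (r x)

/-- The action of renamings on terms, which makes `Tm · τ` a covariant presheaf on contexts. -/
def Tm.rename : ∀ {Γ Δ : Ctx} {k : Kind} {τ : Ty k 0}, Ren Γ Δ → Tm Γ τ → Tm Δ τ
  | _, _, _, _, r, .var x => .var (r x)
  | _, _, _, _, _, .star => .star
  | _, _, _, _, r, .inl v => .inl (v.rename r)
  | _, _, _, _, r, .inr v => .inr (v.rename r)
  | _, _, _, _, r, .vpair v w => .vpair (v.rename r) (w.rename r)
  | _, _, _, _, r, .thunk t => .thunk (t.rename r)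
  | _, _, _, _, r, .prod v => .prod (v.rename r)
  | _, _, _, _, r, .force v => .force (v.rename r)
  | _, _, _, _, r, .lam t => .lam (t.rename (r.lift _))
  | _, _, _, _, r, .app t v => .app (t.rename r) (v.rename r)
  | _, _, _, _, r, .cpair t s => .cpair (t.rename r) (s.rename r)
  | _, _, _, _, r, .fst t => .fst (t.rename r)
  | _, _, _, _, r, .snd t => .snd (t.rename r)
  | _, _, _, _, r, .fold t => .fold (t.rename r)
  | _, _, _, _, r, .unfold h t => .unfold h (t.rename r)
  | _, _, _, _, r, .choice t s => .choice (t.rename r) (s.rename r)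
  | _, _, _, _, r, .toIn s t => .toIn (s.rename r) (t.rename (r.lift _))
  | _, _, _, _, r, .caseOf v s t =>
      .caseOf (v.rename r) (s.rename (r.lift _)) (t.rename (r.lift _))
  | _, _, _, _, r, .pm v t => .pm (v.rename r) (t.rename ((r.lift _).lift _))

/-- Weakening by a fresh variable. -/
def Tm.weaken {Γ : Ctx} {k : Kind} {τ : Ty k 0} (ψ : VTy) (t : Tm Γ τ) : Tm (ψ :: Γ) τ :=
  t.rename (fun _ x => .s x)

/-- Simultaneous substitutions: for every variable of `Γ` a value of the same type over `Δ`. -/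
abbrev Sub (Γ Δ : Ctx) : Type := ∀ ⦃φ : VTy⦄, Var Γ φ → Tm Δ φ

/-- Extension of a substitution under a binder. -/
def Sub.lift {Γ Δ : Ctx} (σ : Sub Γ Δ) (ψ : VTy) : Sub (ψ :: Γ) (ψ :: Δ)
  | _, .z => .var .z
  | _, .s x => (σ x).weaken ψ

/-- The substitution `σ` extended by a value for the most recent variable. -/
def Sub.cons {Γ Δ : Ctx} {ψ : VTy} (v : Tm Δ ψ) (σ : Sub Γ Δ) : Sub (ψ :: Γ) Δ
  | _, .z => v
  | _, .s x => σ x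

/-- A renaming, regarded as a substitution of variables for variables. -/
def Ren.toSub {Γ Δ : Ctx} (r : Ren Γ Δ) : Sub Γ Δ := fun _ x => .var (r x)

/-- Capture-avoiding simultaneous substitution `t[σ]`. -/
def Tm.subst : ∀ {Γ Δ : Ctx} {k : Kind} {τ : Ty k 0}, Sub Γ Δ → Tm Γ τ → Tm Δ τ
  | _, _, _, _, σ, .var x => σ x
  | _, _, _, _, _, .star => .star
  | _, _, _, _, σ, .inl v => .inl (v.subst σ)
  | _, _, _, _, σ, .inr v => .inr (v.subst σ)
  | _, _, _, _, σ, .vpair v w => .vpair (v.subst σ) (w.subst σ)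
  | _, _, _, _, σ, .thunk t => .thunk (t.subst σ)
  | _, _, _, _, σ, .prod v => .prod (v.subst σ)
  | _, _, _, _, σ, .force v => .force (v.subst σ)
  | _, _, _, _, σ, .lam t => .lam (t.subst (σ.lift _))
  | _, _, _, _, σ, .app t v => .app (t.subst σ) (v.subst σ)
  | _, _, _, _, σ, .cpair t s => .cpair (t.subst σ) (s.subst σ)
  | _, _, _, _, σ, .fst t => .fst (t.subst σ)
  | _, _, _, _, σ, .snd t => .snd (t.subst σ)
  | _, _, _, _, σ, .fold t => .fold (t.subst σ)
  | _, _, _, _, σ, .unfold h t => .unfold h (t.subst σ)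
  | _, _, _, _, σ, .choice t s => .choice (t.subst σ) (s.subst σ)
  | _, _, _, _, σ, .toIn s t => .toIn (s.subst σ) (t.subst (σ.lift _))
  | _, _, _, _, σ, .caseOf v s t =>
      .caseOf (v.subst σ) (s.subst (σ.lift _)) (t.subst (σ.lift _))
  | _, _, _, _, σ, .pm v t => .pm (v.subst σ) (t.subst ((σ.lift _).lift _))

/-- `t[v/x]` for the most recent variable `x`. -/
def Tm.inst {Γ : Ctx} {φ : VTy} {k : Kind} {τ : Ty k 0} (t : Tm (φ :: Γ) τ) (v : Tm Γ φ) : Tm Γ τ :=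
  t.subst (Sub.cons v (fun _ x => .var x))

/-! ### Operational semantics -/

/-- One-step reduction `t → t'` of (possibly open) computations; values do not reduce. -/
inductive Step : ∀ {Γ : Ctx} {k : Kind} {τ : Ty k 0}, Tm Γ τ → Tm Γ τ → Prop
  | unfold_fold {Γ : Ctx} {κ : Ty .comp 1} {κ' : CTy} (h : κ.unroll = κ') (t : Tm Γ κ.unroll) :
      Step (.unfold h (.fold t)) (h ▸ t)
  | unfold {Γ : Ctx} {κ : Ty .comp 1} {κ' : CTy} (h : κ.unroll = κ') {t t' : Tm Γ (.mu κ)} :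
      Step t t' → Step (.unfold h t) (.unfold h t')
  | app {Γ : Ctx} {φ : VTy} {κ : CTy} {t t' : Tm Γ (.arr φ κ)} (v : Tm Γ φ) :
      Step t t' → Step (.app t v) (.app t' v)
  | app_lam {Γ : Ctx} {φ : VTy} {κ : CTy} (t : Tm (φ :: Γ) κ) (v : Tm Γ φ) :
      Step (.app (.lam t) v) (t.inst v)
  | fst {Γ : Ctx} {κ₁ κ₂ : CTy} {t t' : Tm Γ (.tensor κ₁ κ₂)} :
      Step t t' → Step (.fst t) (.fst t')
  | snd {Γ : Ctx} {κ₁ κ₂ : CTy} {t t' : Tm Γ (.tensor κ₁ κ₂)} :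
      Step t t' → Step (.snd t) (.snd t')
  | fst_pair {Γ : Ctx} {κ₁ κ₂ : CTy} (t : Tm Γ κ₁) (s : Tm Γ κ₂) : Step (.fst (.cpair t s)) t
  | snd_pair {Γ : Ctx} {κ₁ κ₂ : CTy} (t : Tm Γ κ₁) (s : Tm Γ κ₂) : Step (.snd (.cpair t s)) s
  | choice_left {Γ : Ctx} {κ : CTy} (t s : Tm Γ κ) : Step (.choice t s) t
  | choice_right {Γ : Ctx} {κ : CTy} (t s : Tm Γ κ) : Step (.choice t s) s
  | toIn {Γ : Ctx} {φ : VTy} {κ : CTy} {s s' : Tm Γ (.F φ)} (t : Tm (φ :: Γ) κ) :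
      Step s s' → Step (.toIn s t) (.toIn s' t)
  | toIn_prod {Γ : Ctx} {φ : VTy} {κ : CTy} (v : Tm Γ φ) (t : Tm (φ :: Γ) κ) :
      Step (.toIn (.prod v) t) (.app (.lam t) v)
  | case_inl {Γ : Ctx} {φ₁ φ₂ : VTy} {κ : CTy} (v : Tm Γ φ₁) (s : Tm (φ₁ :: Γ) κ)
      (r : Tm (φ₂ :: Γ) κ) : Step (.caseOf (.inl v) s r) (.app (.lam s) v)
  | case_inr {Γ : Ctx} {φ₁ φ₂ : VTy} {κ : CTy} (v : Tm Γ φ₂) (s : Tm (φ₁ :: Γ) κ)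
      (r : Tm (φ₂ :: Γ) κ) : Step (.caseOf (.inr v) s r) (.app (.lam r) v)
  | force_thunk {Γ : Ctx} {κ : CTy} (t : Tm Γ κ) : Step (.force (.thunk t)) t
  | pm_pair {Γ : Ctx} {φ₁ φ₂ : VTy} {κ : CTy} (v : Tm Γ φ₁) (w : Tm Γ φ₂)
      (t : Tm (φ₁ :: φ₂ :: Γ) κ) :
      Step (.pm (.vpair v w) t) (.app (.lam (.app (.lam t) (v.weaken φ₂))) w)

/-- `t ⇒ t'`: the reflexive transitive closure of one-step reduction. -/
def Steps {Γ : Ctx} {k : Kind} {τ : Ty k 0} : Tm Γ τ → Tm Γ τ → Prop := Relation.ReflTransGen Step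

/-- The terminal computations `prod(v)`, `lam x. t`, `pair(t, s)`, `fold(t)`. -/
def Terminal {Γ : Ctx} : ∀ {k : Kind} {τ : Ty k 0}, Tm Γ τ → Prop
  | _, _, .prod _ => True
  | _, _, .lam _ => True
  | _, _, .cpair _ _ => True
  | _, _, .fold _ => True
  | _, _, _ => False

/-- May-termination `t⇓`: some reduction sequence of `t` ends in a terminal computation.
For closed `t` this says that `t` reduces to a term that does not reduce further,
see `terminates_closed_iff`. -/
def Terminates {Γ : Ctx} {k : Kind} {τ : Ty k 0} (t : Tm Γ τ) : Prop :=
  ∃ t' : Tm Γ τ, Steps t t' ∧ Terminal t'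

/-- A closed computation is terminal or reduces. -/
theorem progress : ∀ {κ : CTy} (t : Tm [] κ), Terminal t ∨ ∃ t', Step t t' := by
  have key : ∀ {Γ : Ctx} {k : Kind} {τ : Ty k 0} (t : Tm Γ τ), Γ = [] →
      (k = .comp → Terminal t ∨ ∃ t', Step t t') := by
    intro Γ k τ t
    induction t with
    | var | star | inl | inr | vpair | thunk => intro _ h; cases h
    | prod | lam | cpair | fold => intro _ _; exact Or.inl trivial
    | choice t s => intro _ _; exact Or.inr ⟨_, .choice_left t s⟩
    | force v =>
      rintro rfl _
      cases v with
      | var x => cases x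
      | thunk t => exact Or.inr ⟨_, .force_thunk t⟩
    | pm v t =>
      rintro rfl _
      cases v with
      | var x => cases x
      | vpair v w => exact Or.inr ⟨_, .pm_pair v w t⟩
    | caseOf v s t =>
      rintro rfl _
      cases v with
      | var x => cases x
      | inl v => exact Or.inr ⟨_, .case_inl v s t⟩
      | inr v => exact Or.inr ⟨_, .case_inr v s t⟩
    | app t v ih =>
      rintro rfl _
      rcases ih rfl rfl with h | ⟨t', h⟩
      · cases t <;> first | exact h.elim | exact Or.inr ⟨_, .app_lam _ _⟩
      · exact Or.inr ⟨_, .app v h⟩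
    | fst t ih =>
      rintro rfl _
      rcases ih rfl rfl with h | ⟨t', h⟩
      · cases t <;> first | exact h.elim | exact Or.inr ⟨_, .fst_pair _ _⟩
      · exact Or.inr ⟨_, .fst h⟩
    | snd t ih =>
      rintro rfl _
      rcases ih rfl rfl with h | ⟨t', h⟩
      · cases t <;> first | exact h.elim | exact Or.inr ⟨_, .snd_pair _ _⟩
      · exact Or.inr ⟨_, .snd h⟩
    | unfold e t ih =>
      rintro rfl _
      rcases ih rfl rfl with h | ⟨t', h⟩
      · cases t <;> first | exact h.elim | exact Or.inr ⟨_, .unfold_fold _ _⟩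
      · exact Or.inr ⟨_, .unfold e h⟩
    | toIn s t ih =>
      rintro rfl _
      rcases ih rfl rfl with h | ⟨t', h⟩
      · cases s <;> first | exact h.elim | exact Or.inr ⟨_, .toIn_prod _ _⟩
      · exact Or.inr ⟨_, .toIn t h⟩
  exact fun {_} t => key t rfl rfl

/-- Terminal terms do not reduce. -/
theorem Terminal.not_step {Γ : Ctx} {k : Kind} {τ : Ty k 0} {t t' : Tm Γ τ} (h : Terminal t) :
    ¬ Step t t' := by
  intro hs
  cases hs <;> exact h

/-- For closed computations, `t⇓` says that `t` reduces to a term that does not reduce further. -/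
theorem terminates_closed_iff {κ : CTy} (t : Tm [] κ) :
    Terminates t ↔ ∃ t' : Tm [] κ, Steps t t' ∧ ∀ t'' : Tm [] κ, ¬ Step t' t'' := by
  constructor
  · rintro ⟨t', h, h'⟩
    exact ⟨t', h, fun _ => h'.not_step⟩
  · rintro ⟨t', h, h'⟩
    exact ⟨t', h, (progress t').resolve_right (fun ⟨t'', h''⟩ => h' t'' h'')⟩

/-! ### Relations on the presheaf of terms -/

/-- Families of relations `R_τ(Γ)` on terms, ordered by pointwise inclusion. -/
abbrev Fam : Type := ∀ (Γ : Ctx) ⦃k : Kind⦄ (τ : Ty k 0), Tm Γ τ → Tm Γ τ → Prop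

/-- `R` is a relation on the presheaf of terms: it is compatible with renamings. -/
def Fam.IsRelation (R : Fam) : Prop :=
  ∀ ⦃Γ Δ : Ctx⦄ (r : Ren Γ Δ) ⦃k : Kind⦄ (τ : Ty k 0) (t s : Tm Γ τ),
    R Γ τ t s → R Δ τ (t.rename r) (s.rename r)

/-- The identity relation. -/
def diag : Fam := fun _ _ _ t s => t = s

/-- `R` is respected by all operations of the language. -/
structure Fam.Compatible (R : Fam) : Prop where
  var {Γ : Ctx} {φ : VTy} (x : Var Γ φ) : R Γ φ (.var x) (.var x)
  star {Γ : Ctx} : R Γ (.unit : VTy) .star .star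
  inl {Γ : Ctx} {φ₁ φ₂ : VTy} {v w : Tm Γ φ₁} :
    R Γ φ₁ v w → R Γ (.sum φ₁ φ₂) (.inl v) (.inl w)
  inr {Γ : Ctx} {φ₁ φ₂ : VTy} {v w : Tm Γ φ₂} :
    R Γ φ₂ v w → R Γ (.sum φ₁ φ₂) (.inr v) (.inr w)
  vpair {Γ : Ctx} {φ₁ φ₂ : VTy} {v w : Tm Γ φ₁} {v' w' : Tm Γ φ₂} :
    R Γ φ₁ v w → R Γ φ₂ v' w' → R Γ (.times φ₁ φ₂) (.vpair v v') (.vpair w w')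
  thunk {Γ : Ctx} {κ : CTy} {t s : Tm Γ κ} : R Γ κ t s → R Γ (.U κ) (.thunk t) (.thunk s)
  prod {Γ : Ctx} {φ : VTy} {v w : Tm Γ φ} : R Γ φ v w → R Γ (.F φ) (.prod v) (.prod w)
  force {Γ : Ctx} {κ : CTy} {v w : Tm Γ (.U κ)} : R Γ (.U κ) v w → R Γ κ (.force v) (.force w)
  lam {Γ : Ctx} {φ : VTy} {κ : CTy} {t s : Tm (φ :: Γ) κ} :
    R (φ :: Γ) κ t s → R Γ (.arr φ κ) (.lam t) (.lam s)
  app {Γ : Ctx} {φ : VTy} {κ : CTy} {t s : Tm Γ (.arr φ κ)} {v w : Tm Γ φ} :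
    R Γ (.arr φ κ) t s → R Γ φ v w → R Γ κ (.app t v) (.app s w)
  cpair {Γ : Ctx} {κ₁ κ₂ : CTy} {t s : Tm Γ κ₁} {t' s' : Tm Γ κ₂} :
    R Γ κ₁ t s → R Γ κ₂ t' s' → R Γ (.tensor κ₁ κ₂) (.cpair t t') (.cpair s s')
  fst {Γ : Ctx} {κ₁ κ₂ : CTy} {t s : Tm Γ (.tensor κ₁ κ₂)} :
    R Γ (.tensor κ₁ κ₂) t s → R Γ κ₁ (.fst t) (.fst s)
  snd {Γ : Ctx} {κ₁ κ₂ : CTy} {t s : Tm Γ (.tensor κ₁ κ₂)} :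
    R Γ (.tensor κ₁ κ₂) t s → R Γ κ₂ (.snd t) (.snd s)
  fold {Γ : Ctx} {κ : Ty .comp 1} {t s : Tm Γ κ.unroll} :
    R Γ κ.unroll t s → R Γ (.mu κ) (.fold t) (.fold s)
  unfold {Γ : Ctx} {κ : Ty .comp 1} {κ' : CTy} (h : κ.unroll = κ') {t s : Tm Γ (.mu κ)} :
    R Γ (.mu κ) t s → R Γ κ' (.unfold h t) (.unfold h s)
  choice {Γ : Ctx} {κ : CTy} {t s t' s' : Tm Γ κ} :
    R Γ κ t s → R Γ κ t' s' → R Γ κ (.choice t t') (.choice s s')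
  toIn {Γ : Ctx} {φ : VTy} {κ : CTy} {t s : Tm Γ (.F φ)} {t' s' : Tm (φ :: Γ) κ} :
    R Γ (.F φ) t s → R (φ :: Γ) κ t' s' → R Γ κ (.toIn t t') (.toIn s s')
  caseOf {Γ : Ctx} {φ₁ φ₂ : VTy} {κ : CTy} {v w : Tm Γ (.sum φ₁ φ₂)}
    {t s : Tm (φ₁ :: Γ) κ} {t' s' : Tm (φ₂ :: Γ) κ} :
    R Γ (.sum φ₁ φ₂) v w → R (φ₁ :: Γ) κ t s → R (φ₂ :: Γ) κ t' s' →
      R Γ κ (.caseOf v t t') (.caseOf w s s')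
  pm {Γ : Ctx} {φ₁ φ₂ : VTy} {κ : CTy} {v w : Tm Γ (.times φ₁ φ₂)}
    {t s : Tm (φ₁ :: φ₂ :: Γ) κ} :
    R Γ (.times φ₁ φ₂) v w → R (φ₁ :: φ₂ :: Γ) κ t s → R Γ κ (.pm v t) (.pm w s)

/-- Congruences on the presheaf of terms (not required to be equivalence relations). -/
def Fam.IsCongruence (R : Fam) : Prop := R.IsRelation ∧ R.Compatible

/-! ### The contextual preorder -/

/-- The observations: nothing on values, may-termination on computations. -/
def obs : Fam := fun _ k _ t s =>
  match k with
  | .val => True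
  | .comp => Terminates t → Terminates s

/-- The contextual preorder: the greatest congruence contained in `obs`, constructed as the join of
all of them; see `ctxPreorder_isGreatest`. -/
def ctxPreorder : Fam := fun Γ _ τ t s => ∃ R : Fam, R.IsCongruence ∧ R ≤ obs ∧ R Γ τ t s

/-- Congruences on the presheaf of terms are reflexive. -/
theorem Fam.Compatible.refl {R : Fam} (hR : R.Compatible) {Γ : Ctx} {k : Kind} {τ : Ty k 0}
    (t : Tm Γ τ) : R Γ τ t t := by
  induction t with
  | var x => exact hR.var x
  | star => exact hR.star
  | inl _ h => exact hR.inl h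
  | inr _ h => exact hR.inr h
  | vpair _ _ h h' => exact hR.vpair h h'
  | thunk _ h => exact hR.thunk h
  | prod _ h => exact hR.prod h
  | force _ h => exact hR.force h
  | lam _ h => exact hR.lam h
  | app _ _ h h' => exact hR.app h h'
  | cpair _ _ h h' => exact hR.cpair h h'
  | fst _ h => exact hR.fst h
  | snd _ h => exact hR.snd h
  | fold _ h => exact hR.fold h
  | unfold e _ h => exact hR.unfold e h
  | choice _ _ h h' => exact hR.choice h h'
  | toIn _ _ h h' => exact hR.toIn h h'
  | caseOf _ _ _ h h' h'' => exact hR.caseOf h h' h''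
  | pm _ _ h h' => exact hR.pm h h'

/-- Two congruences contained in `obs` are contained in a third one, their composite. -/
theorem exists_congruence_ge {R S : Fam} (hR : R.IsCongruence) (hS : S.IsCongruence)
    (hRO : R ≤ obs) (hSO : S ≤ obs) :
    ∃ T : Fam, T.IsCongruence ∧ T ≤ obs ∧ R ≤ T ∧ S ≤ T := by
  refine ⟨fun Γ _ τ t s => ∃ m, R Γ τ t m ∧ S Γ τ m s, ⟨?_, ?_⟩, ?_, ?_, ?_⟩
  · rintro Γ Δ r k τ t s ⟨m, h, h'⟩
    exact ⟨_, hR.1 r τ _ _ h, hS.1 r τ _ _ h'⟩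
  · have a := hR.2
    have b := hS.2
    constructor
    · exact fun x => ⟨_, a.var x, b.var x⟩
    · exact ⟨_, a.star, b.star⟩
    · rintro _ _ _ _ _ ⟨_, h, g⟩; exact ⟨_, a.inl h, b.inl g⟩
    · rintro _ _ _ _ _ ⟨_, h, g⟩; exact ⟨_, a.inr h, b.inr g⟩
    · rintro _ _ _ _ _ _ _ ⟨_, h, g⟩ ⟨_, h', g'⟩; exact ⟨_, a.vpair h h', b.vpair g g'⟩
    · rintro _ _ _ _ ⟨_, h, g⟩; exact ⟨_, a.thunk h, b.thunk g⟩
    · rintro _ _ _ _ ⟨_, h, g⟩; exact ⟨_, a.prod h, b.prod g⟩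
    · rintro _ _ _ _ ⟨_, h, g⟩; exact ⟨_, a.force h, b.force g⟩
    · rintro _ _ _ _ _ ⟨_, h, g⟩; exact ⟨_, a.lam h, b.lam g⟩
    · rintro _ _ _ _ _ _ _ ⟨_, h, g⟩ ⟨_, h', g'⟩; exact ⟨_, a.app h h', b.app g g'⟩
    · rintro _ _ _ _ _ _ _ ⟨_, h, g⟩ ⟨_, h', g'⟩; exact ⟨_, a.cpair h h', b.cpair g g'⟩
    · rintro _ _ _ _ _ ⟨_, h, g⟩; exact ⟨_, a.fst h, b.fst g⟩
    · rintro _ _ _ _ _ ⟨_, h, g⟩; exact ⟨_, a.snd h, b.snd g⟩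
    · rintro _ _ _ _ ⟨_, h, g⟩; exact ⟨_, a.fold h, b.fold g⟩
    · rintro _ _ _ e _ _ ⟨_, h, g⟩; exact ⟨_, a.unfold e h, b.unfold e g⟩
    · rintro _ _ _ _ _ _ ⟨_, h, g⟩ ⟨_, h', g'⟩; exact ⟨_, a.choice h h', b.choice g g'⟩
    · rintro _ _ _ _ _ _ _ ⟨_, h, g⟩ ⟨_, h', g'⟩; exact ⟨_, a.toIn h h', b.toIn g g'⟩
    · rintro _ _ _ _ _ _ _ _ _ _ ⟨_, h, g⟩ ⟨_, h', g'⟩ ⟨_, h'', g''⟩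
      exact ⟨_, a.caseOf h h' h'', b.caseOf g g' g''⟩
    · rintro _ _ _ _ _ _ _ _ ⟨_, h, g⟩ ⟨_, h', g'⟩; exact ⟨_, a.pm h h', b.pm g g'⟩
  · rintro Γ k τ t s ⟨m, h, h'⟩
    have h₁ := hRO Γ _ τ t m h
    have h₂ := hSO Γ _ τ m s h'
    cases k with
    | val => trivial
    | comp => exact fun ht => h₂ (h₁ ht)
  · exact fun Γ k τ t s h => ⟨s, h, hS.2.refl s⟩
  · exact fun Γ k τ t s h => ⟨t, hR.2.refl t, h⟩

/-- The contextual preorder is the greatest congruence contained in `obs`. -/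
theorem ctxPreorder_isGreatest : IsGreatest {R : Fam | R.IsCongruence ∧ R ≤ obs} ctxPreorder := by
  have le : ∀ {T : Fam}, T.IsCongruence → T ≤ obs → T ≤ ctxPreorder :=
    fun hT hO Γ k τ t s h => ⟨_, hT, hO, h⟩
  have join : ∀ {Γ Γ' : Ctx} {k k' : Kind} {τ : Ty k 0} {τ' : Ty k' 0} {t s : Tm Γ τ}
      {t' s' : Tm Γ' τ'}, ctxPreorder Γ τ t s → ctxPreorder Γ' τ' t' s' →
      ∃ T : Fam, T.IsCongruence ∧ T ≤ obs ∧ T Γ τ t s ∧ T Γ' τ' t' s' := by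
    rintro _ _ _ _ _ _ _ _ _ _ ⟨R, hR, hRO, h⟩ ⟨S, hS, hSO, h'⟩
    obtain ⟨T, hT, hTO, hRT, hST⟩ := exists_congruence_ge hR hS hRO hSO
    exact ⟨T, hT, hTO, hRT _ _ _ _ _ h, hST _ _ _ _ _ h'⟩
  have hd : (diag).IsCongruence ∧ diag ≤ obs := by
    refine ⟨⟨?_, ?_⟩, ?_⟩
    · rintro _ _ _ _ _ _ _ rfl; rfl
    · constructor <;> intros <;> simp_all [diag]
    · rintro _ k _ _ _ rfl
      cases k with
      | val => trivial
      | comp => exact id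
  refine ⟨⟨⟨?_, ?_⟩, ?_⟩, fun R hR => le hR.1 hR.2⟩
  · rintro Γ Δ r k τ t s ⟨R, hR, hO, h⟩
    exact ⟨R, hR, hO, hR.1 r τ _ _ h⟩
  · constructor
    · exact fun x => ⟨_, hd.1, hd.2, rfl⟩
    · exact ⟨_, hd.1, hd.2, rfl⟩
    · rintro _ _ _ _ _ ⟨R, c, o, h⟩; exact ⟨R, c, o, c.2.inl h⟩
    · rintro _ _ _ _ _ ⟨R, c, o, h⟩; exact ⟨R, c, o, c.2.inr h⟩
    · intro _ _ _ _ _ _ _ h h'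
      obtain ⟨R, c, o, h, h'⟩ := join h h'
      exact ⟨R, c, o, c.2.vpair h h'⟩
    · rintro _ _ _ _ ⟨R, c, o, h⟩; exact ⟨R, c, o, c.2.thunk h⟩
    · rintro _ _ _ _ ⟨R, c, o, h⟩; exact ⟨R, c, o, c.2.prod h⟩
    · rintro _ _ _ _ ⟨R, c, o, h⟩; exact ⟨R, c, o, c.2.force h⟩
    · rintro _ _ _ _ _ ⟨R, c, o, h⟩; exact ⟨R, c, o, c.2.lam h⟩
    · intro _ _ _ _ _ _ _ h h'
      obtain ⟨R, c, o, h, h'⟩ := join h h'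
      exact ⟨R, c, o, c.2.app h h'⟩
    · intro _ _ _ _ _ _ _ h h'
      obtain ⟨R, c, o, h, h'⟩ := join h h'
      exact ⟨R, c, o, c.2.cpair h h'⟩
    · rintro _ _ _ _ _ ⟨R, c, o, h⟩; exact ⟨R, c, o, c.2.fst h⟩
    · rintro _ _ _ _ _ ⟨R, c, o, h⟩; exact ⟨R, c, o, c.2.snd h⟩
    · rintro _ _ _ _ ⟨R, c, o, h⟩; exact ⟨R, c, o, c.2.fold h⟩
    · rintro _ _ _ e _ _ ⟨R, c, o, h⟩; exact ⟨R, c, o, c.2.unfold e h⟩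
    · intro _ _ _ _ _ _ h h'
      obtain ⟨R, c, o, h, h'⟩ := join h h'
      exact ⟨R, c, o, c.2.choice h h'⟩
    · intro _ _ _ _ _ _ _ h h'
      obtain ⟨R, c, o, h, h'⟩ := join h h'
      exact ⟨R, c, o, c.2.toIn h h'⟩
    · intro _ _ _ _ _ _ _ _ _ _ h h' h''
      obtain ⟨R, c, o, h, h'⟩ := join h h'
      obtain ⟨S, c', o', h''⟩ := h''
      obtain ⟨T, d, p, l, l'⟩ := exists_congruence_ge c c' o o'
      exact ⟨T, d, p, d.2.caseOf (l _ _ _ _ _ h) (l _ _ _ _ _ h') (l' _ _ _ _ _ h'')⟩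
    · intro _ _ _ _ _ _ _ _ h h'
      obtain ⟨R, c, o, h, h'⟩ := join h h'
      exact ⟨R, c, o, c.2.pm h h'⟩
  · rintro Γ k τ t s ⟨R, _, o, h⟩
    exact o Γ _ τ t s h

/-! ### Applicative similarity and the step-indexed logical relation -/

/-- Matching of the introduction forms: what has to hold of `s` when `t` is an introduction form.
Related functions have to send inputs related by `Q`, in every context reached by a renaming,
to outputs related by `S`. -/
def matchIntro (Q S : Fam) {Γ : Ctx} : ∀ {k : Kind} {τ : Ty k 0}, Tm Γ τ → Tm Γ τ → Prop
  | _, _, .star, s => s = .star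
  | _, _, .thunk (κ := κ) t', s => ∃ s', s = .thunk s' ∧ S Γ κ t' s'
  | _, _, .inl (φ₁ := φ₁) v, s => ∃ w, s = .inl w ∧ S Γ φ₁ v w
  | _, _, .inr (φ₂ := φ₂) v, s => ∃ w, s = .inr w ∧ S Γ φ₂ v w
  | _, _, .vpair (φ₁ := φ₁) (φ₂ := φ₂) v₁ v₂, s =>
      ∃ w₁ w₂, s = .vpair w₁ w₂ ∧ S Γ φ₁ v₁ w₁ ∧ S Γ φ₂ v₂ w₂
  | _, _, .cpair (κ₁ := κ₁) (κ₂ := κ₂) t₁ t₂, s =>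
      ∃ s₁ s₂, Steps s (.cpair s₁ s₂) ∧ S Γ κ₁ t₁ s₁ ∧ S Γ κ₂ t₂ s₂
  | _, _, .fold (κ := κ) t', s => ∃ s', Steps s (.fold s') ∧ S Γ κ.unroll t' s'
  | _, _, .lam (φ := φ) (κ := κ) M, s =>
      ∃ N, Steps s (.lam N) ∧ ∀ (Δ : Ctx) (r : Ren Γ Δ) (v w : Tm Δ φ), Q Δ φ v w →
        S Δ κ (M.subst (Sub.cons v r.toSub)) (N.subst (Sub.cons w r.toSub))
  | _, _, .prod (φ := φ) v, s => ∃ w, Steps s (.prod w) ∧ S Γ φ v w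
  | _, _, _, _ => True

/-- The pairs `(t, s)` such that the strong behaviour of `t` is matched by the weak behaviour of `s`,
with inputs related by `Q` and outputs related by `S`. -/
structure BehRel (Q S : Fam) (Γ : Ctx) ⦃k : Kind⦄ (τ : Ty k 0) (t s : Tm Γ τ) : Prop where
  subst : ∀ (Δ : Ctx) (u w : Sub Γ Δ),
    (∀ (φ : VTy) (x : Var Γ φ), Q Δ φ (u x) (w x)) → S Δ τ (t.subst u) (s.subst w)
  step : ∀ t' : Tm Γ τ, Step t t' → ∃ s' : Tm Γ τ, Steps s s' ∧ S Γ τ t' s'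
  intro_form : matchIntro Q S t s

/-- Applicative (weak) simulations: related terms send equal inputs to related outputs. -/
def IsAppSimulation (R : Fam) : Prop := R.IsRelation ∧ R ≤ BehRel diag R

/-- Applicative similarity: the union of all applicative simulations. -/
def appSim : Fam := fun Γ _ τ t s => ∃ R : Fam, IsAppSimulation R ∧ R Γ τ t s

/-- The relations `𝓛^α`, by transfinite recursion: `𝓛^0` relates all terms of equal type, related
terms at stage `α + 1` send inputs related at stage `α` to outputs related at stage `α`, and at limit
stages one takes the intersection. -/
noncomputable def logRelStage (α : Ordinal.{0}) : Fam :=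
  Ordinal.limitRecOn α (motive := fun _ => Fam) ⊤ (fun _ L => L ⊓ BehRel L L)
    (fun β _ L => ⨅ (γ : Ordinal.{0}) (h : γ < β), L γ h)

/-- The step-indexed logical relation `𝓛`, the intersection of all `𝓛^α`. -/
noncomputable def logRel : Fam := ⨅ α : Ordinal.{0}, logRelStage α

end CBPV

/-!
The contextual preorder is the greatest congruence contained in the observations, so it suffices to
show that the logical relation is a congruence (`logRel_isCongruence`), that it is contained in the
observations (`logRel_le_obs`), and that it contains applicative similarity (`appSim_le_logRel`).

*Congruence.* Every stage `𝓛^α` is a congruence, by transfinite induction on `α`. The only stages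
of interest are the successors, and there the claim is that `S ⊓ BehRel S S` is a congruence
whenever `S` is (`Fam.IsCongruence.inf_behRel`). Let an operation be applied to related terms. If a
reduction takes place in a subterm, the reducts are related by `S` because `S` is a congruence; if a
redex fires, the matching clause for introduction forms provides a weak match for the term in
principal position, and `S` relates the contracta. For `lam`, the substitution clause for the body
is what turns related inputs into related outputs. Compatibility with renamings needs that renamings
preserve and reflect reduction (`Step.rename`, `Step.exists_of_rename`).

*Adequacy.* A computation that terminates in `n` steps can be related at stage `n + 1` only to
computations that terminate (`Terminates.exists_stage`), so the finite stages suffice.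

*Similarity.* If `𝓛^α` relates `t` to `m` and an applicative simulation relates `m` to `s`, then `𝓛^α`
relates `t` to `s` (`IsAppSimulation.logRelStage_comp`, by transfinite induction on `α`): related
inputs are fed to `t` and `m`, and equal ones to `m` and `s`. Congruences are reflexive, so `t = m`
may be taken here, and every applicative simulation lies in every `𝓛^α`.
-/

namespace CBPV

/-! ### Renaming and substitution -/

theorem Ren.lift_comp {Γ Δ Θ : Ctx} (r : Ren Γ Δ) (r' : Ren Δ Θ) (ψ : VTy) :
    (fun _ x => r'.lift ψ (r.lift ψ x) : Ren (ψ :: Γ) (ψ :: Θ)) =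
      Ren.lift (fun _ x => r' (r x)) ψ := by
  funext φ x; cases x <;> rfl

theorem Tm.rename_rename {Γ Δ Θ : Ctx} {k : Kind} {τ : Ty k 0} (t : Tm Γ τ) (r : Ren Γ Δ)
    (r' : Ren Δ Θ) : (t.rename r).rename r' = t.rename (fun _ x => r' (r x)) := by
  induction t generalizing Δ Θ with
  | var | star => rfl
  | inl _ ih | inr _ ih | thunk _ ih | prod _ ih | force _ ih | fst _ ih | snd _ ih | fold _ ih
  | unfold _ _ ih => simp only [Tm.rename, ih]
  | vpair _ _ ih ih' | app _ _ ih ih' | cpair _ _ ih ih' | choice _ _ ih ih' =>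
    simp only [Tm.rename, ih, ih']
  | lam _ ih => simp only [Tm.rename, ih, Ren.lift_comp]
  | toIn _ _ ih ih' | pm _ _ ih ih' => simp only [Tm.rename, ih, ih', Ren.lift_comp]
  | caseOf _ _ _ ih ih' ih'' => simp only [Tm.rename, ih, ih', ih'', Ren.lift_comp]

theorem Sub.lift_comp_ren {Γ Δ Θ : Ctx} (r : Ren Γ Δ) (σ : Sub Δ Θ) (ψ : VTy) :
    (fun _ x => σ.lift ψ (r.lift ψ x) : Sub (ψ :: Γ) (ψ :: Θ)) =
      Sub.lift (fun _ x => σ (r x)) ψ := by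
  funext φ x; cases x <;> rfl

theorem Tm.subst_rename {Γ Δ Θ : Ctx} {k : Kind} {τ : Ty k 0} (t : Tm Γ τ) (r : Ren Γ Δ)
    (σ : Sub Δ Θ) : (t.rename r).subst σ = t.subst (fun _ x => σ (r x)) := by
  induction t generalizing Δ Θ with
  | var | star => rfl
  | inl _ ih | inr _ ih | thunk _ ih | prod _ ih | force _ ih | fst _ ih | snd _ ih | fold _ ih
  | unfold _ _ ih => simp only [Tm.rename, Tm.subst, ih]
  | vpair _ _ ih ih' | app _ _ ih ih' | cpair _ _ ih ih' | choice _ _ ih ih' =>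
    simp only [Tm.rename, Tm.subst, ih, ih']
  | lam _ ih => simp only [Tm.rename, Tm.subst, ih, Sub.lift_comp_ren]
  | toIn _ _ ih ih' | pm _ _ ih ih' => simp only [Tm.rename, Tm.subst, ih, ih', Sub.lift_comp_ren]
  | caseOf _ _ _ ih ih' ih'' => simp only [Tm.rename, Tm.subst, ih, ih', ih'', Sub.lift_comp_ren]

theorem Tm.rename_weaken {Γ Δ : Ctx} {k : Kind} {τ : Ty k 0} (t : Tm Γ τ) (r : Ren Γ Δ)
    (ψ : VTy) : (t.weaken ψ).rename (r.lift ψ) = (t.rename r).weaken ψ := by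
  simp only [Tm.weaken, Tm.rename_rename, Ren.lift]

theorem Sub.ren_comp_lift {Γ Δ Θ : Ctx} (σ : Sub Γ Δ) (r : Ren Δ Θ) (ψ : VTy) :
    (fun _ x => (σ.lift ψ x).rename (r.lift ψ) : Sub (ψ :: Γ) (ψ :: Θ)) =
      Sub.lift (fun _ x => (σ x).rename r) ψ := by
  funext φ x
  cases x with
  | z => rfl
  | s x => exact Tm.rename_weaken _ _ _

theorem Tm.rename_subst {Γ Δ Θ : Ctx} {k : Kind} {τ : Ty k 0} (t : Tm Γ τ) (σ : Sub Γ Δ)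
    (r : Ren Δ Θ) : (t.subst σ).rename r = t.subst (fun _ x => (σ x).rename r) := by
  induction t generalizing Δ Θ with
  | var | star => rfl
  | inl _ ih | inr _ ih | thunk _ ih | prod _ ih | force _ ih | fst _ ih | snd _ ih | fold _ ih
  | unfold _ _ ih => simp only [Tm.rename, Tm.subst, ih]
  | vpair _ _ ih ih' | app _ _ ih ih' | cpair _ _ ih ih' | choice _ _ ih ih' =>
    simp only [Tm.rename, Tm.subst, ih, ih']
  | lam _ ih => simp only [Tm.rename, Tm.subst, ih, Sub.ren_comp_lift]
  | toIn _ _ ih ih' | pm _ _ ih ih' => simp only [Tm.rename, Tm.subst, ih, ih', Sub.ren_comp_lift]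
  | caseOf _ _ _ ih ih' ih'' => simp only [Tm.rename, Tm.subst, ih, ih', ih'', Sub.ren_comp_lift]

theorem Tm.rename_inst {Γ Δ : Ctx} {φ : VTy} {k : Kind} {τ : Ty k 0} (t : Tm (φ :: Γ) τ)
    (v : Tm Γ φ) (r : Ren Γ Δ) :
    (t.inst v).rename r = (t.rename (r.lift φ)).inst (v.rename r) := by
  simp only [Tm.inst, Tm.rename_subst, Tm.subst_rename]
  congr 1
  funext ψ x
  cases x <;> rfl

/-- Substituting `[r', v/x]` after a renaming `r` under the binder of `x` is substituting
`[r' ∘ r, v/x]`. -/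
theorem Tm.subst_cons_rename_lift {Γ Δ Θ : Ctx} {φ : VTy} {k : Kind} {τ : Ty k 0}
    (t : Tm (φ :: Γ) τ) (r : Ren Γ Δ) (r' : Ren Δ Θ) (v : Tm Θ φ) :
    (t.rename (r.lift φ)).subst (Sub.cons v r'.toSub) =
      t.subst (Sub.cons v (Ren.toSub (fun _ x => r' (r x)))) := by
  rw [Tm.subst_rename]
  congr 1
  funext ψ x
  cases x <;> rfl

/-! ### Renaming and reduction -/

theorem Step.rename {Γ Δ : Ctx} (r : Ren Γ Δ) {k : Kind} {τ : Ty k 0} {t t' : Tm Γ τ}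
    (h : Step t t') : Step (t.rename r) (t'.rename r) := by
  induction h generalizing Δ with
  | unfold_fold h t => subst h; exact .unfold_fold rfl _
  | unfold h _ ih => exact .unfold h (ih r)
  | app v _ ih => exact .app _ (ih r)
  | app_lam t v => rw [Tm.rename_inst]; exact .app_lam _ _
  | fst _ ih => exact .fst (ih r)
  | snd _ ih => exact .snd (ih r)
  | fst_pair t s => exact .fst_pair _ _
  | snd_pair t s => exact .snd_pair _ _
  | choice_left t s => exact .choice_left _ _
  | choice_right t s => exact .choice_right _ _
  | toIn t _ ih => exact .toIn _ (ih r)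
  | toIn_prod v t => exact .toIn_prod _ _
  | case_inl v s r => exact .case_inl _ _ _
  | case_inr v s r => exact .case_inr _ _ _
  | force_thunk t => exact .force_thunk _
  | pm_pair v w t =>
    simp only [Tm.rename, Tm.rename_weaken]
    exact .pm_pair _ _ _

theorem Steps.rename {Γ Δ : Ctx} (r : Ren Γ Δ) {k : Kind} {τ : Ty k 0} {t t' : Tm Γ τ}
    (h : Steps t t') : Steps (t.rename r) (t'.rename r) :=
  Relation.ReflTransGen.lift (Tm.rename r) (fun _ _ => Step.rename r) _ _ h

/-- Renamings reflect reduction: a renaming maps variables to variables, so it creates no redex. -/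
theorem Step.exists_of_rename {Γ Δ : Ctx} (r : Ren Γ Δ) {k : Kind} {τ : Ty k 0} {t : Tm Γ τ}
    {t' : Tm Δ τ} (h : Step (t.rename r) t') : ∃ t₀, Step t t₀ ∧ t' = t₀.rename r := by
  induction t generalizing Δ with
  | var | star | inl | inr | vpair | thunk | prod | lam | cpair | fold => cases h
  | force v =>
    simp only [Tm.rename] at h
    generalize e : v.rename r = v₀ at h
    cases h
    cases v <;> cases e
    exact ⟨_, .force_thunk _, rfl⟩
  | app t v ih _ =>
    simp only [Tm.rename] at h
    generalize e : t.rename r = t₀ at h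
    cases h with
    | app _ h =>
      subst e
      obtain ⟨t₁, h₁, rfl⟩ := ih r h
      exact ⟨_, .app _ h₁, rfl⟩
    | app_lam =>
      cases t <;> cases e
      exact ⟨_, .app_lam _ _, (Tm.rename_inst _ _ _).symm⟩
  | fst t ih =>
    simp only [Tm.rename] at h
    generalize e : t.rename r = t₀ at h
    cases h with
    | fst h =>
      subst e
      obtain ⟨t₁, h₁, rfl⟩ := ih r h
      exact ⟨_, .fst h₁, rfl⟩
    | fst_pair =>
      cases t <;> cases e
      exact ⟨_, .fst_pair _ _, rfl⟩
  | snd t ih =>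
    simp only [Tm.rename] at h
    generalize e : t.rename r = t₀ at h
    cases h with
    | snd h =>
      subst e
      obtain ⟨t₁, h₁, rfl⟩ := ih r h
      exact ⟨_, .snd h₁, rfl⟩
    | snd_pair =>
      cases t <;> cases e
      exact ⟨_, .snd_pair _ _, rfl⟩
  | unfold e t ih =>
    subst e
    simp only [Tm.rename] at h
    generalize e : t.rename r = t₀ at h
    cases h with
    | unfold _ h =>
      subst e
      obtain ⟨t₁, h₁, rfl⟩ := ih r h
      exact ⟨_, .unfold _ h₁, rfl⟩
    | unfold_fold =>
      cases t <;> cases e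
      exact ⟨_, .unfold_fold _ _, rfl⟩
  | choice t s =>
    cases h
    · exact ⟨_, .choice_left _ _, rfl⟩
    · exact ⟨_, .choice_right _ _, rfl⟩
  | toIn s t ih _ =>
    simp only [Tm.rename] at h
    generalize e : s.rename r = s₀ at h
    cases h with
    | toIn _ h =>
      subst e
      obtain ⟨t₁, h₁, rfl⟩ := ih r h
      exact ⟨_, .toIn _ h₁, rfl⟩
    | toIn_prod =>
      cases s <;> cases e
      exact ⟨_, .toIn_prod _ _, rfl⟩
  | caseOf v s t =>
    simp only [Tm.rename] at h
    generalize e : v.rename r = v₀ at h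
    cases h with
    | case_inl =>
      cases v <;> cases e
      exact ⟨_, .case_inl _ _ _, rfl⟩
    | case_inr =>
      cases v <;> cases e
      exact ⟨_, .case_inr _ _ _, rfl⟩
  | pm v t =>
    simp only [Tm.rename] at h
    generalize e : v.rename r = v₀ at h
    cases h
    cases v <;> cases e
    refine ⟨_, .pm_pair _ _ _, ?_⟩
    simp only [Tm.rename, Tm.rename_weaken]

theorem matchIntro.rename {Q S : Fam} (hS : S.IsRelation) {Γ Δ : Ctx} (r : Ren Γ Δ) {k : Kind}
    {τ : Ty k 0} {t s : Tm Γ τ} (h : matchIntro Q S t s) :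
    matchIntro Q S (t.rename r) (s.rename r) := by
  cases t with
  | var | force | app | fst | snd | unfold | choice | toIn | caseOf | pm => trivial
  | star => obtain rfl := h; rfl
  | inl v => obtain ⟨w, rfl, h⟩ := h; exact ⟨_, rfl, hS r _ _ _ h⟩
  | inr v => obtain ⟨w, rfl, h⟩ := h; exact ⟨_, rfl, hS r _ _ _ h⟩
  | vpair v v' =>
    obtain ⟨w, w', rfl, h, h'⟩ := h
    exact ⟨_, _, rfl, hS r _ _ _ h, hS r _ _ _ h'⟩
  | thunk t => obtain ⟨w, rfl, h⟩ := h; exact ⟨_, rfl, hS r _ _ _ h⟩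
  | prod v => obtain ⟨w, hs, h⟩ := h; exact ⟨_, hs.rename r, hS r _ _ _ h⟩
  | cpair t t' =>
    obtain ⟨w, w', hs, h, h'⟩ := h
    exact ⟨_, _, hs.rename r, hS r _ _ _ h, hS r _ _ _ h'⟩
  | fold t => obtain ⟨w, hs, h⟩ := h; exact ⟨_, hs.rename r, hS r _ _ _ h⟩
  | lam M =>
    obtain ⟨N, hs, h⟩ := h
    refine ⟨_, hs.rename r, fun Θ r' v w hvw => ?_⟩
    rw [Tm.subst_cons_rename_lift, Tm.subst_cons_rename_lift]
    exact h Θ _ v w hvw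

theorem BehRel.isRelation {Q S : Fam} (hS : S.IsRelation) : Fam.IsRelation (BehRel Q S) := by
  intro Γ Δ r k τ t s h
  refine ⟨fun Θ u w huw => ?_, fun t' ht' => ?_, h.intro_form.rename hS r⟩
  · rw [Tm.subst_rename, Tm.subst_rename]
    exact h.subst Θ _ _ fun φ x => huw φ (r x)
  · obtain ⟨t₀, ht₀, rfl⟩ := Step.exists_of_rename r ht'
    obtain ⟨s₀, hs₀, h₀⟩ := h.step t₀ ht₀
    exact ⟨_, hs₀.rename r, hS r _ _ _ h₀⟩

/-! ### The stages of the logical relation are congruences -/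

theorem Steps.unfold {Γ : Ctx} {κ : Ty .comp 1} {κ' : CTy} (e : κ.unroll = κ')
    {t t' : Tm Γ (.mu κ)} (h : Steps t t') : Steps (.unfold e t) (.unfold e t') :=
  Relation.ReflTransGen.lift (Tm.unfold e) (fun _ _ => Step.unfold e) _ _ h

theorem Steps.app {Γ : Ctx} {φ : VTy} {κ : CTy} (v : Tm Γ φ) {t t' : Tm Γ (.arr φ κ)}
    (h : Steps t t') : Steps (.app t v) (.app t' v) :=
  Relation.ReflTransGen.lift (fun t => Tm.app t v) (fun _ _ => Step.app v) _ _ h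

theorem Steps.fst {Γ : Ctx} {κ₁ κ₂ : CTy} {t t' : Tm Γ (.tensor κ₁ κ₂)} (h : Steps t t') :
    Steps (.fst t) (.fst t') :=
  Relation.ReflTransGen.lift Tm.fst (fun _ _ => Step.fst) _ _ h

theorem Steps.snd {Γ : Ctx} {κ₁ κ₂ : CTy} {t t' : Tm Γ (.tensor κ₁ κ₂)} (h : Steps t t') :
    Steps (.snd t) (.snd t') :=
  Relation.ReflTransGen.lift Tm.snd (fun _ _ => Step.snd) _ _ h

theorem Steps.toIn {Γ : Ctx} {φ : VTy} {κ : CTy} (t : Tm (φ :: Γ) κ) {s s' : Tm Γ (.F φ)}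
    (h : Steps s s') : Steps (.toIn s t) (.toIn s' t) :=
  Relation.ReflTransGen.lift (fun s => Tm.toIn s t) (fun _ _ => Step.toIn t) _ _ h

theorem Fam.IsCongruence.sub_lift {S : Fam} (hS : S.IsCongruence) {Γ Δ : Ctx} {u w : Sub Γ Δ}
    (h : ∀ (φ : VTy) (x : Var Γ φ), S Δ φ (u x) (w x)) (ψ φ : VTy) (x : Var (ψ :: Γ) φ) :
    S (ψ :: Δ) φ (u.lift ψ x) (w.lift ψ x) := by
  cases x with
  | z => exact hS.2.var _
  | s x => exact hS.1 _ _ _ _ (h φ x)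

/-- The key step: one unfolding of the behaviour of a congruence, with inputs and outputs both
related by it, is again a congruence. The substitution clause of `BehRel` carries the case of
binders, and the compatibility of `S` itself carries the reducts in which no redex has fired. -/
theorem Fam.IsCongruence.inf_behRel {S : Fam} (hS : S.IsCongruence) :
    Fam.IsCongruence (S ⊓ BehRel S S) := by
  have c := hS.2
  refine ⟨fun Γ Δ r k τ t s h => ⟨hS.1 r τ t s h.1, BehRel.isRelation hS.1 r τ t s h.2⟩, ?_⟩
  constructor
  case var =>
    intro _ _ x
    refine ⟨c.var x, fun Δ u w h => h _ x, fun t' ht => ?_, trivial⟩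
    cases ht
  case star =>
    refine ⟨c.star, fun Δ u w h => c.star, fun t' ht => ?_, rfl⟩
    cases ht
  case inl =>
    intro _ _ _ v w h
    refine ⟨c.inl h.1, fun Δ u w hu => c.inl (h.2.subst Δ u w hu), fun t' ht => ?_,
      ⟨_, rfl, h.1⟩⟩
    cases ht
  case inr =>
    intro _ _ _ v w h
    refine ⟨c.inr h.1, fun Δ u w hu => c.inr (h.2.subst Δ u w hu), fun t' ht => ?_,
      ⟨_, rfl, h.1⟩⟩
    cases ht
  case vpair =>
    intro _ _ _ v w v' w' h h'
    refine ⟨c.vpair h.1 h'.1, fun Δ u w hu => c.vpair (h.2.subst Δ u w hu) (h'.2.subst Δ u w hu),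
      fun t' ht => ?_, ⟨_, _, rfl, h.1, h'.1⟩⟩
    cases ht
  case thunk =>
    intro _ _ t s h
    refine ⟨c.thunk h.1, fun Δ u w hu => c.thunk (h.2.subst Δ u w hu), fun t' ht => ?_,
      ⟨_, rfl, h.1⟩⟩
    cases ht
  case prod =>
    intro _ _ v w h
    refine ⟨c.prod h.1, fun Δ u w hu => c.prod (h.2.subst Δ u w hu), fun t' ht => ?_,
      ⟨_, .refl, h.1⟩⟩
    cases ht
  case force =>
    intro _ _ v w h
    refine ⟨c.force h.1, fun Δ u w hu => c.force (h.2.subst Δ u w hu), fun t' ht => ?_, trivial⟩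
    cases ht with
    | force_thunk t =>
      obtain ⟨s, rfl, hs⟩ := h.2.intro_form
      exact ⟨s, .single (.force_thunk s), hs⟩
  case lam =>
    intro _ _ _ t s h
    refine ⟨c.lam h.1, fun Δ u w hu => c.lam (h.2.subst _ _ _ (hS.sub_lift hu _)),
      fun t' ht => ?_, ⟨s, .refl, fun Δ r v w hvw => h.2.subst Δ _ _ fun φ x => ?_⟩⟩
    · cases ht
    · cases x with
      | z => exact hvw
      | s x => exact c.var _
  case app =>
    intro _ _ _ t s v w h h'
    refine ⟨c.app h.1 h'.1, fun Δ u w hu => c.app (h.2.subst Δ u w hu) (h'.2.subst Δ u w hu),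
      fun t' ht => ?_, trivial⟩
    cases ht with
    | app _ ht =>
      obtain ⟨s', hs, h₁⟩ := h.2.step _ ht
      exact ⟨_, hs.app w, c.app h₁ h'.1⟩
    | app_lam M =>
      obtain ⟨N, hs, hN⟩ := h.2.intro_form
      exact ⟨_, (hs.app w).tail (.app_lam N w), hN _ (fun _ x => x) v w h'.1⟩
  case cpair =>
    intro _ _ _ t s t' s' h h'
    refine ⟨c.cpair h.1 h'.1, fun Δ u w hu => c.cpair (h.2.subst Δ u w hu) (h'.2.subst Δ u w hu),
      fun t' ht => ?_, ⟨_, _, .refl, h.1, h'.1⟩⟩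
    cases ht
  case fst =>
    intro _ _ _ t s h
    refine ⟨c.fst h.1, fun Δ u w hu => c.fst (h.2.subst Δ u w hu), fun t' ht => ?_, trivial⟩
    cases ht with
    | fst ht =>
      obtain ⟨s', hs, h₁⟩ := h.2.step _ ht
      exact ⟨_, hs.fst, c.fst h₁⟩
    | fst_pair =>
      obtain ⟨s₁, s₂, hs, h₁, -⟩ := h.2.intro_form
      exact ⟨_, hs.fst.tail (.fst_pair s₁ s₂), h₁⟩
  case snd =>
    intro _ _ _ t s h
    refine ⟨c.snd h.1, fun Δ u w hu => c.snd (h.2.subst Δ u w hu), fun t' ht => ?_, trivial⟩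
    cases ht with
    | snd ht =>
      obtain ⟨s', hs, h₁⟩ := h.2.step _ ht
      exact ⟨_, hs.snd, c.snd h₁⟩
    | snd_pair =>
      obtain ⟨s₁, s₂, hs, -, h₂⟩ := h.2.intro_form
      exact ⟨_, hs.snd.tail (.snd_pair s₁ s₂), h₂⟩
  case fold =>
    intro _ _ t s h
    refine ⟨c.fold h.1, fun Δ u w hu => c.fold (h.2.subst Δ u w hu), fun t' ht => ?_,
      ⟨_, .refl, h.1⟩⟩
    cases ht
  case unfold =>
    intro _ _ _ e t s h
    subst e
    refine ⟨c.unfold rfl h.1, fun Δ u w hu => c.unfold rfl (h.2.subst Δ u w hu),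
      fun t' ht => ?_, trivial⟩
    cases ht with
    | unfold _ ht =>
      obtain ⟨s', hs, h₁⟩ := h.2.step _ ht
      exact ⟨_, hs.unfold rfl, c.unfold rfl h₁⟩
    | unfold_fold =>
      obtain ⟨s', hs, h₁⟩ := h.2.intro_form
      exact ⟨_, (hs.unfold rfl).tail (.unfold_fold rfl s'), h₁⟩
  case choice =>
    intro _ _ t s t' s' h h'
    refine ⟨c.choice h.1 h'.1,
      fun Δ u w hu => c.choice (h.2.subst Δ u w hu) (h'.2.subst Δ u w hu), fun t' ht => ?_, trivial⟩
    cases ht with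
    | choice_left => exact ⟨_, .single (.choice_left _ _), h.1⟩
    | choice_right => exact ⟨_, .single (.choice_right _ _), h'.1⟩
  case toIn =>
    intro _ _ _ t s t' s' h h'
    refine ⟨c.toIn h.1 h'.1, fun Δ u w hu => c.toIn (h.2.subst Δ u w hu)
      (h'.2.subst _ _ _ (hS.sub_lift hu _)), fun t' ht => ?_, trivial⟩
    cases ht with
    | toIn _ ht =>
      obtain ⟨s₁, hs, h₁⟩ := h.2.step _ ht
      exact ⟨_, hs.toIn s', c.toIn h₁ h'.1⟩
    | toIn_prod =>
      obtain ⟨w, hs, h₁⟩ := h.2.intro_form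
      exact ⟨_, (hs.toIn s').tail (.toIn_prod w s'), c.app (c.lam h'.1) h₁⟩
  case caseOf =>
    intro _ _ _ _ v w t s t' s' h h' h''
    refine ⟨c.caseOf h.1 h'.1 h''.1, fun Δ u w hu => c.caseOf (h.2.subst Δ u w hu)
      (h'.2.subst _ _ _ (hS.sub_lift hu _)) (h''.2.subst _ _ _ (hS.sub_lift hu _)),
      fun t' ht => ?_, trivial⟩
    cases ht with
    | case_inl =>
      obtain ⟨w, rfl, h₁⟩ := h.2.intro_form
      exact ⟨_, .single (.case_inl w s s'), c.app (c.lam h'.1) h₁⟩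
    | case_inr =>
      obtain ⟨w, rfl, h₁⟩ := h.2.intro_form
      exact ⟨_, .single (.case_inr w s s'), c.app (c.lam h''.1) h₁⟩
  case pm =>
    intro _ _ _ _ v w t s h h'
    refine ⟨c.pm h.1 h'.1, fun Δ u w hu => c.pm (h.2.subst Δ u w hu)
      (h'.2.subst _ _ _ (hS.sub_lift (hS.sub_lift hu _) _)), fun t' ht => ?_, trivial⟩
    cases ht with
    | pm_pair =>
      obtain ⟨w₁, w₂, rfl, h₁, h₂⟩ := h.2.intro_form
      exact ⟨_, .single (.pm_pair w₁ w₂ s),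
        c.app (c.lam (c.app (c.lam h'.1) (hS.1 _ _ _ _ h₁))) h₂⟩

theorem Fam.iInf_iff {ι : Sort*} {R : ι → Fam} {Γ : Ctx} {k : Kind} {τ : Ty k 0} {t s : Tm Γ τ} :
    (⨅ i, R i) Γ τ t s ↔ ∀ i, R i Γ τ t s := by
  simp only [iInf_apply, iInf_Prop_eq]

theorem Fam.IsCongruence.iInf {ι : Sort*} {R : ι → Fam} (hR : ∀ i, (R i).IsCongruence) :
    Fam.IsCongruence (⨅ i, R i) := by
  refine ⟨fun Γ Δ r k τ t s h => ?_, ?_⟩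
  · rw [Fam.iInf_iff] at h ⊢
    exact fun i => (hR i).1 r τ t s (h i)
  · constructor <;> intros <;> simp only [Fam.iInf_iff] at * <;> intro i
    · exact (hR i).2.var _
    · exact (hR i).2.star
    · exact (hR i).2.inl (by solve_by_elim)
    · exact (hR i).2.inr (by solve_by_elim)
    · exact (hR i).2.vpair (by solve_by_elim) (by solve_by_elim)
    · exact (hR i).2.thunk (by solve_by_elim)
    · exact (hR i).2.prod (by solve_by_elim)
    · exact (hR i).2.force (by solve_by_elim)
    · exact (hR i).2.lam (by solve_by_elim)
    · exact (hR i).2.app (by solve_by_elim) (by solve_by_elim)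
    · exact (hR i).2.cpair (by solve_by_elim) (by solve_by_elim)
    · exact (hR i).2.fst (by solve_by_elim)
    · exact (hR i).2.snd (by solve_by_elim)
    · exact (hR i).2.fold (by solve_by_elim)
    · exact (hR i).2.unfold _ (by solve_by_elim)
    · exact (hR i).2.choice (by solve_by_elim) (by solve_by_elim)
    · exact (hR i).2.toIn (by solve_by_elim) (by solve_by_elim)
    · exact (hR i).2.caseOf (by solve_by_elim) (by solve_by_elim) (by solve_by_elim)
    · exact (hR i).2.pm (by solve_by_elim) (by solve_by_elim)

theorem logRelStage_zero : logRelStage 0 = ⊤ :=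
  Ordinal.limitRecOn_zero ..

theorem logRelStage_add_one (α : Ordinal.{0}) :
    logRelStage (α + 1) = logRelStage α ⊓ BehRel (logRelStage α) (logRelStage α) :=
  Ordinal.limitRecOn_add_one ..

theorem logRelStage_limit {α : Ordinal.{0}} (h : Order.IsSuccLimit α) :
    logRelStage α = ⨅ (γ : Ordinal.{0}) (_ : γ < α), logRelStage γ :=
  Ordinal.limitRecOn_limit (h := h) ..

theorem logRelStage_isCongruence (α : Ordinal.{0}) : (logRelStage α).IsCongruence := by
  induction α using Ordinal.limitRecOn with
  | zero =>
    rw [logRelStage_zero, ← iInf_of_empty (Empty.elim : Empty → Fam)]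
    exact .iInf fun i => i.elim
  | add_one α ih => rw [logRelStage_add_one]; exact ih.inf_behRel
  | limit α h ih =>
    rw [logRelStage_limit h]
    exact .iInf fun γ => .iInf fun hγ => ih γ hγ

theorem logRel_isCongruence : logRel.IsCongruence :=
  .iInf logRelStage_isCongruence

/-! ### Adequacy of the logical relation -/

theorem matchIntro.terminates {Q S : Fam} {Γ : Ctx} {k : Kind} {τ : Ty k 0} {t s : Tm Γ τ}
    (ht : Terminal t) (h : matchIntro Q S t s) : Terminates s := by
  cases t with
  | prod | fold | lam => obtain ⟨w, hs, -⟩ := h; exact ⟨_, hs, trivial⟩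
  | cpair => obtain ⟨w, w', hs, -⟩ := h; exact ⟨_, hs, trivial⟩
  | _ => exact ht.elim

/-- If `t` terminates after `n` steps, then already the stage `n + 1` of the logical relation forces
termination of the terms that `t` is related to. -/
theorem Terminates.exists_stage {Γ : Ctx} {k : Kind} {τ : Ty k 0} {t : Tm Γ τ}
    (h : Terminates t) :
    ∃ n : ℕ, ∀ s : Tm Γ τ, logRelStage n Γ τ t s → Terminates s := by
  obtain ⟨t', h, ht'⟩ := h
  induction h using Relation.ReflTransGen.head_induction_on with
  | refl =>
    refine ⟨1, fun s hs => ?_⟩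
    rw [Nat.cast_one, ← zero_add 1, logRelStage_add_one] at hs
    exact hs.2.intro_form.terminates ht'
  | head h _ ih =>
    obtain ⟨n, hn⟩ := ih
    refine ⟨n + 1, fun s hs => ?_⟩
    rw [Nat.cast_add_one, logRelStage_add_one] at hs
    obtain ⟨s', hs', h'⟩ := hs.2.step _ h
    obtain ⟨s'', hs'', hT⟩ := hn s' h'
    exact ⟨s'', hs'.trans hs'', hT⟩

theorem logRel_le_obs : logRel ≤ obs := by
  intro Γ k τ t s h
  cases k with
  | val => trivial
  | comp =>
    intro ht
    obtain ⟨n, hn⟩ := ht.exists_stage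
    exact hn s (Fam.iInf_iff.1 h n)

theorem logRel_le_ctxPreorder : logRel ≤ ctxPreorder :=
  ctxPreorder_isGreatest.2 ⟨logRel_isCongruence, logRel_le_obs⟩

/-! ### Applicative similarity is contained in the logical relation -/

theorem IsAppSimulation.steps {R : Fam} (hR : IsAppSimulation R) {Γ : Ctx} {k : Kind} {τ : Ty k 0}
    {m m' s : Tm Γ τ} (h : Steps m m') (hms : R Γ τ m s) : ∃ s', Steps s s' ∧ R Γ τ m' s' := by
  induction h with
  | refl => exact ⟨s, .refl, hms⟩
  | tail _ h ih =>
    obtain ⟨s₁, hs₁, h₁⟩ := ih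
    obtain ⟨s₂, hs₂, h₂⟩ := (hR.2 _ _ _ _ _ h₁).step _ h
    exact ⟨s₂, hs₁.trans hs₂, h₂⟩

/-- Postcomposition with an applicative simulation: on the left the inputs are related by `Q`, on the
right they are equal, so the composite sends inputs related by `Q` to outputs in the composite of
the outputs. -/
theorem BehRel.comp_appSimulation {Q S R : Fam} (hR : IsAppSimulation R)
    (hSR : ∀ {Γ : Ctx} {k : Kind} {τ : Ty k 0} {t m s : Tm Γ τ},
      S Γ τ t m → R Γ τ m s → S Γ τ t s)
    {Γ : Ctx} {k : Kind} {τ : Ty k 0} {t m s : Tm Γ τ} (h : BehRel Q S Γ τ t m)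
    (hms : R Γ τ m s) : BehRel Q S Γ τ t s := by
  refine ⟨fun Δ u w huw => ?_, fun t' ht => ?_, ?_⟩
  · exact hSR (h.subst Δ u w huw) ((hR.2 _ _ _ _ _ hms).subst Δ w w fun _ _ => rfl)
  · obtain ⟨m', hm, h'⟩ := h.step t' ht
    obtain ⟨s', hs, hms'⟩ := hR.steps hm hms
    exact ⟨s', hs, hSR h' hms'⟩
  · have hi := h.intro_form
    cases t with
    | var | force | app | fst | snd | unfold | choice | toIn | caseOf | pm => trivial
    | star =>
      obtain rfl := hi
      exact (hR.2 _ _ _ _ _ hms).intro_form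
    | inl | inr | thunk =>
      obtain ⟨w, rfl, h₁⟩ := hi
      obtain ⟨w', rfl, h₂⟩ := (hR.2 _ _ _ _ _ hms).intro_form
      exact ⟨_, rfl, hSR h₁ h₂⟩
    | vpair =>
      obtain ⟨v, w, rfl, h₁, h₂⟩ := hi
      obtain ⟨v', w', rfl, h₁', h₂'⟩ := (hR.2 _ _ _ _ _ hms).intro_form
      exact ⟨_, _, rfl, hSR h₁ h₁', hSR h₂ h₂'⟩
    | prod | fold =>
      obtain ⟨w, hm, h₁⟩ := hi
      obtain ⟨s', hs, hms'⟩ := hR.steps hm hms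
      obtain ⟨w', hs', h₂⟩ := (hR.2 _ _ _ _ _ hms').intro_form
      exact ⟨_, hs.trans hs', hSR h₁ h₂⟩
    | cpair =>
      obtain ⟨v, w, hm, h₁, h₂⟩ := hi
      obtain ⟨s', hs, hms'⟩ := hR.steps hm hms
      obtain ⟨v', w', hs', h₁', h₂'⟩ := (hR.2 _ _ _ _ _ hms').intro_form
      exact ⟨_, _, hs.trans hs', hSR h₁ h₁', hSR h₂ h₂'⟩
    | lam =>
      obtain ⟨N, hm, h₁⟩ := hi
      obtain ⟨s', hs, hms'⟩ := hR.steps hm hms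
      obtain ⟨P, hs', h₂⟩ := (hR.2 _ _ _ _ _ hms').intro_form
      exact ⟨P, hs.trans hs', fun Δ r v w hvw => hSR (h₁ Δ r v w hvw) (h₂ Δ r w w rfl)⟩

theorem IsAppSimulation.logRelStage_comp {R : Fam} (hR : IsAppSimulation R) (α : Ordinal.{0})
    {Γ : Ctx} {k : Kind} {τ : Ty k 0} {t m s : Tm Γ τ} (h : logRelStage α Γ τ t m)
    (hms : R Γ τ m s) : logRelStage α Γ τ t s := by
  induction α using Ordinal.limitRecOn generalizing Γ k with
  | zero => rw [logRelStage_zero]; trivial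
  | add_one α ih =>
    rw [logRelStage_add_one] at h ⊢
    exact ⟨ih h.1 hms, h.2.comp_appSimulation hR ih hms⟩
  | limit α hα ih =>
    simp only [logRelStage_limit hα, Fam.iInf_iff] at h ⊢
    exact fun γ hγ => ih γ hγ (h γ hγ) hms

/-- Being a congruence, the logical relation is reflexive, and it absorbs applicative similarity on
the right; this takes the place of Howe's method. -/
theorem appSim_le_logRel : appSim ≤ logRel := by
  rintro Γ k τ p q ⟨R, hR, hpq⟩
  exact Fam.iInf_iff.2 fun α =>
    hR.logRelStage_comp α ((logRelStage_isCongruence α).2.refl p) hpq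

end CBPV

theorem mainTheorem2 (Γ : CBPV.Ctx) (k : CBPV.Kind) (τ : CBPV.Ty k 0) (p q : CBPV.Tm Γ τ) :
    (CBPV.appSim Γ τ p q → CBPV.ctxPreorder Γ τ p q) ∧
      (CBPV.logRel Γ τ p q → CBPV.ctxPreorder Γ τ p q) :=
  ⟨fun h => CBPV.logRel_le_ctxPreorder Γ k τ p q (CBPV.appSim_le_logRel Γ k τ p q h),
    fun h => CBPV.logRel_le_ctxPreorder Γ k τ p q h⟩
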